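/- For a unital C*-algebra $B$ and $n\ge 1$ let $\mathrm{Lg}_n(B)\subset B^n$ be the set of $n$-tuples that generate $B$ as a left ideal, and let the topological stable rank $\mathrm{tsr}(B)\in\{1,2,\dots,\infty\}$ be the least $n\ge 1$ such that $\mathrm{Lg}_n(B)$ is dense in $B^n$ ($\infty$ if there is no such $n$). A C*-algebra has Property (SP) if each of its nonzero hereditary C*-subalgebras contains a nonzero projection. Proposition. Let $A$ be a unital C*-algebra and let $D\subset A$ be an infinite-dimensional C*-subalgebra containing the unit of $A$. Assume that (i) $D$ is simple (it is nonzero and has no closed two-sided ideals other than $0$ and $D$); (ii) $D$ has Property (SP); (iii) $\sup\{\mathrm{tsr}(pAp) : p\in D \text{ a projection}\}<\infty$, where $pAp$ is regarded as a C*-algebra with unit $p$. Then $\mathrm{tsr}(A)\le 2$. -/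

import Mathlib

/-- `Lg R n` is the set of all `n`-tuples of elements of `R` that generate `R` as a left ideal
(`Ideal` is Mathlib's notion of a left ideal). -/
def Lg (R : Type*) [Ring R] (n : ℕ) : Set (Fin n → R) :=
  {a | Ideal.span (Set.range a) = ⊤}

/-- The topological stable rank: the least integer `n ≥ 1` such that `Lg R n` is dense in `R ^ n`,
and `⊤` if there is no such `n`. Only the ring structure and the topology enter; it is used for
unital C⋆-algebras with their norm topology. -/
noncomputable def tsr (R : Type*) [Ring R] [TopologicalSpace R] : ℕ∞ :=
  sInf {m : ℕ∞ | ∃ n : ℕ, 1 ≤ n ∧ Dense (Lg R n) ∧ m = n}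

/-- The corner `p A p`, whose ring structure (with unit `p`) is provided by Mathlib, carries the
topology induced from `A`. -/
instance IsIdempotentElem.Corner.instTopologicalSpace {A : Type*} [Semigroup A]
    [TopologicalSpace A] {p : A} (hp : IsIdempotentElem p) : TopologicalSpace hp.Corner :=
  inferInstanceAs (TopologicalSpace (Subsemigroup.corner p))

/-- A C⋆-algebra is simple if it is nonzero and its only closed two-sided ideals are `0` and the
whole algebra. -/
structure IsSimpleCStarAlgebra (A : Type*) [NonUnitalCStarAlgebra A] : Prop where
  nontrivial : Nontrivial A
  eq_bot_or_eq_top : ∀ I : TwoSidedIdeal A, IsClosed (I : Set A) → I = ⊥ ∨ I = ⊤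

/-- A hereditary C⋆-subalgebra: a norm-closed ⋆-subalgebra `B` such that `0 ≤ a ≤ b` and `b ∈ B`
imply `a ∈ B`, for the order of `A` in which the positive elements are the self-adjoint elements
with nonnegative spectrum. -/
structure IsHereditary {A : Type*} [NonUnitalCStarAlgebra A]
    (B : NonUnitalStarSubalgebra ℂ A) : Prop where
  isClosed : IsClosed (B : Set A)
  mem_of_le : letI := CStarAlgebra.spectralOrder A
    ∀ a b : A, 0 ≤ a → a ≤ b → b ∈ B → a ∈ B

/-- Property (SP): every nonzero hereditary C⋆-subalgebra contains a nonzero projection. -/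
def PropertySP (A : Type*) [NonUnitalCStarAlgebra A] : Prop :=
  ∀ B : NonUnitalStarSubalgebra ℂ A, IsHereditary B → B ≠ ⊥ →
    ∃ p ∈ B, IsStarProjection p ∧ p ≠ 0

open Matrix

/-! A pair in `A` is traded for a tall matrix over a small corner `qAq`. Let `N` bound the ranks of
all corners by projections of `D`. By (SP) and infinite dimension each nonzero projection of `D` has
two orthogonal copies of a nonzero projection below it; iterating gives `q ≠ 0` in `D` with `2 ^ N`
orthogonal copies below 1. By simplicity `q` is full, `∑ x i * q * y i = 1`, so `A` is a corner of
`M_L(qAq)` via `a ↦ Y a X` with `X Y = 1`.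

If `qAq` has rank `k + 1`, the left invertible `(L + k) × L` matrices over it are dense. A pair `(a,
b)` becomes the matrix with upper block `Y a X + F`, where `F = Q - Y X`, and lower block `U b X`;
here `U` is a column of length `k` with `U V = Q`, which exists because `k ≤ N ≤ 2 ^ N`. Perturb
this matrix to a left invertible one, then eliminate the `F` part by a Schur complement. The `k`
lower rows lift through `U` to a single entry, so a generating pair close to `(a, b)` results. -/

/-- The left invertible `m × n` matrices over `R` form a dense set. -/
def DenseLeftInvertible (m n R : Type*) [Fintype m] [DecidableEq n] [Ring R]
    [TopologicalSpace R] : Prop :=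
  Dense {Z : Matrix m n R | ∃ W : Matrix n m R, W * Z = 1}

/-! ### Density of left invertible rectangular matrices -/

namespace DenseLeftInvertible

variable {l m n m' n' R : Type*} [Fintype l] [Fintype m] [Fintype n] [Fintype m'] [Fintype n']
  [DecidableEq l] [DecidableEq n] [DecidableEq m] [DecidableEq n'] [Ring R] [TopologicalSpace R]

omit [Fintype n] [Fintype n'] [DecidableEq m] in
theorem reindex (h : DenseLeftInvertible m n R) (e : m ≃ m') (f : n ≃ n') :
    DenseLeftInvertible m' n' R := by
  have hsurj : Function.Surjective (Matrix.reindex e f : Matrix m n R → Matrix m' n' R) :=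
    (Matrix.reindex e f).surjective
  have hcont : Continuous (Matrix.reindex e f : Matrix m n R → Matrix m' n' R) :=
    continuous_id.matrix_reindex e f
  refine (hsurj.denseRange.dense_image hcont h).mono ?_
  rintro _ ⟨Z, ⟨W, hW⟩, rfl⟩
  refine ⟨Matrix.reindex f e W, ?_⟩
  simp [Matrix.reindex_apply, Matrix.submatrix_mul_equiv, hW]

omit [Fintype n] [DecidableEq l] [DecidableEq m] in
theorem add_rows (h : DenseLeftInvertible m n R) : DenseLeftInvertible (l ⊕ m) n R := by
  intro Z
  have hc : Continuous fun M : Matrix m n R => Matrix.fromRows Z.toRows₁ M := by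
    refine continuous_matrix ?_
    rintro (i | i) j
    · exact continuous_const
    · exact continuous_id.matrix_elem i j
  have h0 := mem_closure_image hc.continuousAt (h Z.toRows₂)
  rw [Matrix.fromRows_toRows] at h0
  refine closure_mono ?_ h0
  rintro _ ⟨M, ⟨W, hW⟩, rfl⟩
  exact ⟨Matrix.fromCols 0 W, by simp [Matrix.fromCols_mul_fromRows, hW]⟩

/-- Once the lower left block `c'` has a left inverse `y`, adding `(1 - a) * y` times the lower rows
to the upper ones turns `a` into 1. Clearing `c'` leaves the Schur complement `d - c' * b'`, which
alone is then perturbed; the row operations stay fixed. -/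
theorem add [IsTopologicalRing R] (h₁ : DenseLeftInvertible m l R)
    (h₂ : DenseLeftInvertible m n R) : DenseLeftInvertible (l ⊕ m) (l ⊕ n) R := by
  intro Z
  obtain ⟨a, b, c, d, rfl⟩ : ∃ a b c d, Z = fromBlocks a b c d :=
    ⟨_, _, _, _, (fromBlocks_toBlocks Z).symm⟩
  have hc : Continuous fun c' : Matrix m l R => fromBlocks a b c' d :=
    continuous_const.matrix_fromBlocks continuous_const continuous_id continuous_const
  have h0 := mem_closure_image hc.continuousAt (h₁ c)
  refine closure_minimal ?_ isClosed_closure h0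
  rintro _ ⟨c', ⟨y, hy⟩, rfl⟩
  set g := (1 - a) * y with hg
  set b' := b + g * d with hb'
  have hc₂ : Continuous fun e : Matrix m n R =>
      (fromBlocks 1 (-g) 0 1 : Matrix (l ⊕ m) (l ⊕ m) R) *
        ((fromBlocks 1 0 c' 1 : Matrix (l ⊕ m) (l ⊕ m) R) *
          (fromBlocks 1 b' 0 e : Matrix (l ⊕ m) (l ⊕ n) R)) :=
    continuous_const.matrix_mul (continuous_const.matrix_mul
      (continuous_const.matrix_fromBlocks continuous_const continuous_const continuous_id))
  have h3 := mem_closure_image hc₂.continuousAt (h₂ (d - c' * b'))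
  have h4 : (fromBlocks 1 (-g) 0 1 : Matrix (l ⊕ m) (l ⊕ m) R) *
      ((fromBlocks 1 0 c' 1 : Matrix (l ⊕ m) (l ⊕ m) R) *
        (fromBlocks 1 b' 0 (d - c' * b') : Matrix (l ⊕ m) (l ⊕ n) R)) =
      fromBlocks a b c' d := by
    have : g * c' = 1 - a := by rw [hg, Matrix.mul_assoc, hy, Matrix.mul_one]
    simp [fromBlocks_multiply, this, hb']
  rw [h4] at h3
  refine closure_mono ?_ h3
  rintro _ ⟨e, ⟨w, hw⟩, rfl⟩
  refine ⟨(fromBlocks 1 (-(b' * w)) 0 w : Matrix (l ⊕ n) (l ⊕ m) R) *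
    ((fromBlocks 1 0 (-c') 1 : Matrix (l ⊕ m) (l ⊕ m) R) *
      (fromBlocks 1 g 0 1 : Matrix (l ⊕ m) (l ⊕ m) R)), ?_⟩
  have e₁ : (fromBlocks 1 g 0 1 : Matrix (l ⊕ m) (l ⊕ m) R) * fromBlocks 1 (-g) 0 1 = 1 := by
    simp [fromBlocks_multiply]
  have e₂ : (fromBlocks 1 0 (-c') 1 : Matrix (l ⊕ m) (l ⊕ m) R) * fromBlocks 1 0 c' 1 = 1 := by
    simp [fromBlocks_multiply]
  have e₃ : (fromBlocks 1 (-(b' * w)) 0 w : Matrix (l ⊕ n) (l ⊕ m) R) *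
      (fromBlocks 1 b' 0 e : Matrix (l ⊕ m) (l ⊕ n) R) = 1 := by
    simp [fromBlocks_multiply, hw, Matrix.mul_assoc]
  rw [Matrix.mul_assoc, Matrix.mul_assoc,
    ← Matrix.mul_assoc (fromBlocks 1 g 0 1 : Matrix (l ⊕ m) (l ⊕ m) R), e₁, Matrix.one_mul,
    ← Matrix.mul_assoc (fromBlocks 1 0 (-c') 1 : Matrix (l ⊕ m) (l ⊕ m) R), e₂, Matrix.one_mul, e₃]

end DenseLeftInvertible

theorem mem_Lg_iff {R : Type*} [Ring R] {n : ℕ} {a : Fin n → R} :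
    a ∈ Lg R n ↔ ∃ w : Fin n → R, ∑ i, w i * a i = 1 := by
  rw [Lg, Set.mem_ofPred_eq, Ideal.eq_top_iff_one, Ideal.mem_span_range_iff_exists_fun]

theorem denseLeftInvertible_of_dense_Lg {R : Type*} [Ring R] [TopologicalSpace R] {n : ℕ}
    (h : Dense (Lg R n)) : DenseLeftInvertible (Fin n) (Fin 1) R := by
  have hsurj : Function.Surjective fun (a : Fin n → R) => Matrix.replicateCol (Fin 1) a := by
    intro Z
    refine ⟨fun i => Z i 0, ?_⟩
    ext i j
    simp [Subsingleton.elim j 0]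
  have hcont : Continuous fun (a : Fin n → R) => Matrix.replicateCol (Fin 1) a :=
    continuous_id.matrix_replicateCol
  refine (hsurj.denseRange.dense_image hcont h).mono ?_
  rintro _ ⟨a, ha, rfl⟩
  obtain ⟨w, hw⟩ := mem_Lg_iff.1 ha
  refine ⟨Matrix.replicateRow (Fin 1) w, ?_⟩
  ext i j
  obtain rfl := Subsingleton.elim i j
  simp [Matrix.mul_apply, hw]

/-- If the topological stable rank is at most `k + 1`, then the left invertible matrices with `L`
columns and `L + k` rows are dense. -/
theorem DenseLeftInvertible.of_dense_Lg {R : Type*} [Ring R] [TopologicalSpace R]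
    [IsTopologicalRing R] {k : ℕ} (h : Dense (Lg R (k + 1))) (L : ℕ) :
    DenseLeftInvertible (Fin L ⊕ Fin k) (Fin L) R := by
  have h₁ := denseLeftInvertible_of_dense_Lg h
  -- The induction must start at one column: a step from zero columns would need density for columns
  -- of length `k`, not `k + 1`.
  rcases L with _ | L
  · intro Z
    exact subset_closure ⟨0, Subsingleton.elim _ _⟩
  suffices h : DenseLeftInvertible (Fin (L + (k + 1))) (Fin (L + 1)) R from
    h.reindex ((finCongr (by omega)).trans finSumFinEquiv.symm) (Equiv.refl _)
  induction L with
  | zero => exact h₁.reindex (finCongr (by omega)) (Equiv.refl _)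
  | succ L ih =>
    have h₂ : DenseLeftInvertible (Fin (L + (k + 1))) (Fin 1) R :=
      (h₁.add_rows (l := Fin L)).reindex finSumFinEquiv (Equiv.refl _)
    exact (h₂.add ih).reindex (finSumFinEquiv.trans (finCongr (by omega)))
      (finSumFinEquiv.trans (finCongr (by omega)))

/-! ### Compression from matrices over a corner to pairs -/

theorem eventually_isUnit_and_continuousAt_inverse (R : Type*) [NormedRing R] [CompleteSpace R] :
    (∀ᶠ x : R in nhds 1, IsUnit x) ∧ ContinuousAt (Ring.inverse : R → R) 1 :=
  ⟨Units.isOpen.mem_nhds isUnit_one, NormedRing.inverse_continuousAt 1⟩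

theorem Matrix.eventually_isUnit_and_continuousAt_inverse (n A : Type*) [Fintype n] [DecidableEq n]
    [NormedRing A] [CompleteSpace A] :
    (∀ᶠ x : Matrix n n A in nhds 1, IsUnit x) ∧
      ContinuousAt (Ring.inverse : Matrix n n A → Matrix n n A) 1 :=
  let N : NormedRing (Matrix n n A) := Matrix.linftyOpNormedRing
  @_root_.eventually_isUnit_and_continuousAt_inverse (Matrix n n A) N
    (inferInstanceAs (CompleteSpace (n → n → A)))

/-- The corrected column `G = Y - F * u' * F * Z₁ * Y` satisfies `X * G = 1` and `F * Z₁ * G = 0`.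
Hence inserting `Y * X = Q - F` before `Z₁ * G` changes nothing, and the product is `X * Q * G = 1`.
-/
theorem Matrix.mul_schur_compression_eq_one {o ι κ R : Type*} [Fintype o] [DecidableEq o]
    [Fintype ι] [DecidableEq ι] [Fintype κ] [Ring R] {X : Matrix o ι R} {Y : Matrix ι o R}
    {Q F u' Z₁ W₁ : Matrix ι ι R} {T : Matrix κ ι R} {W₂ : Matrix ι κ R} {U : Matrix κ o R}
    {Z₂ : Matrix o ι R} (hXY : X * Y = 1) (hQ : Q * Q = Q) (hXQ : X * Q = X) (hQY : Q * Y = Y)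
    (hQZ : Q * Z₁ = Z₁) (hW : W₁ * Z₁ + W₂ * T = Q) (hU : U * Z₂ = T) (hF : F = Q - Y * X)
    (hu : (1 - F + F * Z₁ * F) * u' = 1) :
    (X * W₁ * Y) * (X * Z₁ * (Y - F * u' * F * Z₁ * Y)) +
      (X * W₂ * U) * (Z₂ * (Y - F * u' * F * Z₁ * Y)) = 1 := by
  have hXF : X * F = 0 := by
    rw [hF, Matrix.mul_sub, hXQ, ← Matrix.mul_assoc, hXY, Matrix.one_mul, sub_self]
  have hFF : F * F = F := by
    nth_rw 1 [hF]
    rw [Matrix.sub_mul, Matrix.mul_assoc, hXF, Matrix.mul_zero, sub_zero, hF, Matrix.mul_sub, hQ,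
      ← Matrix.mul_assoc, hQY]
  set G := Y - F * u' * F * Z₁ * Y with hG
  have hFu : F * Z₁ * F * u' = F := by
    have : F * (1 - F + F * Z₁ * F) = F * Z₁ * F := by
      rw [Matrix.mul_add, Matrix.mul_sub, Matrix.mul_one, hFF, sub_self, zero_add,
        ← Matrix.mul_assoc, ← Matrix.mul_assoc, hFF]
    rw [← this, Matrix.mul_assoc, hu, Matrix.mul_one]
  have hXG : X * G = 1 := by
    rw [hG, Matrix.mul_sub, hXY]
    simp only [← Matrix.mul_assoc, hXF, Matrix.zero_mul, sub_zero]
  have hFZG : F * Z₁ * G = 0 := by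
    rw [hG, Matrix.mul_sub]
    simp only [← Matrix.mul_assoc]
    rw [hFu, hFF, sub_self]
  have hYX : Y * X * Z₁ * G = Z₁ * G := by
    have : Y * X = Q - F := by rw [hF, sub_sub_cancel]
    rw [this, Matrix.sub_mul, hQZ, Matrix.sub_mul, hFZG, sub_zero]
  calc _ = X * W₁ * (Y * X * Z₁ * G) + X * W₂ * (U * Z₂) * G := by simp only [Matrix.mul_assoc]
    _ = X * (W₁ * Z₁ + W₂ * T) * G := by
      rw [hYX, hU]
      simp only [Matrix.mul_assoc, Matrix.mul_add, Matrix.add_mul]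
    _ = 1 := by rw [hW, hXQ, hXG]

section Corner

variable {A : Type*}

/-- The inclusion of a corner. -/
def IsIdempotentElem.Corner.subtype [NonUnitalRing A] {q : A} (hq : IsIdempotentElem q) :
    hq.Corner →ₙ+* A where
  toFun := Subtype.val
  map_zero' := rfl
  map_add' _ _ := rfl
  map_mul' _ _ := rfl

/-- The compression onto a corner. -/
def IsIdempotentElem.Corner.compress [NonUnitalRing A] {q : A} (hq : IsIdempotentElem q)
    (a : A) : hq.Corner := ⟨q * a * q, a, rfl⟩

theorem IsIdempotentElem.Corner.continuous_subtype [NonUnitalRing A] [TopologicalSpace A] {q : A}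
    (hq : IsIdempotentElem q) :
    Continuous (IsIdempotentElem.Corner.subtype hq) :=
  continuous_subtype_val

instance IsIdempotentElem.Corner.instIsTopologicalRing [Ring A] [TopologicalSpace A]
    [IsTopologicalRing A] {q : A} (hq : IsIdempotentElem q) : IsTopologicalRing hq.Corner where
  continuous_add := by
    refine Continuous.subtype_mk ?_ _
    exact (continuous_subtype_val.comp continuous_fst).add
      (continuous_subtype_val.comp continuous_snd)
  continuous_mul := by
    refine Continuous.subtype_mk ?_ _
    exact (continuous_subtype_val.comp continuous_fst).mul
      (continuous_subtype_val.comp continuous_snd)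
  continuous_neg := by
    refine Continuous.subtype_mk ?_ _
    exact continuous_subtype_val.neg

end Corner

theorem dense_Lg_two_of_corner {A : Type*} [NormedRing A] [CompleteSpace A] {q : A}
    (hq : IsIdempotentElem q) {k L : ℕ}
    {X : Matrix (Fin 1) (Fin L) A} {Y : Matrix (Fin L) (Fin 1) A}
    {U : Matrix (Fin k) (Fin 1) A} {V : Matrix (Fin 1) (Fin k) A}
    (hXY : X * Y = 1) (hXQ : X * (diagonal fun _ => q : Matrix (Fin L) (Fin L) A) = X)
    (hQY : (diagonal fun _ => q : Matrix (Fin L) (Fin L) A) * Y = Y)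
    (hUV : U * V = diagonal (fun _ => q)) 
    (hQU : (diagonal fun _ => q : Matrix (Fin k) (Fin k) A) * U = U)
    (hd : DenseLeftInvertible (Fin L ⊕ Fin k) (Fin L) hq.Corner) : Dense (Lg A 2) := by
  intro a
  set Q : Matrix (Fin L) (Fin L) A := diagonal (fun _ => q) with hQdef
  have hQ : Q * Q = Q := by rw [hQdef, diagonal_mul_diagonal, hq.eq]
  set F := Q - Y * X with hF
  have hXF : X * F = 0 := by
    rw [hF, Matrix.mul_sub, hXQ, ← Matrix.mul_assoc, hXY, Matrix.one_mul, sub_self]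
  have hFY : F * Y = 0 := by
    rw [hF, Matrix.sub_mul, hQY, Matrix.mul_assoc, hXY, Matrix.mul_one, sub_self]
  have hFF : F * F = F := by
    nth_rw 1 [hF]
    rw [Matrix.sub_mul, Matrix.mul_assoc, hXF, Matrix.mul_zero, sub_zero, hF, Matrix.mul_sub, hQ,
      ← Matrix.mul_assoc, hQY]
  let a₁ : Matrix (Fin 1) (Fin 1) A := of fun _ _ => a 0
  let a₂ : Matrix (Fin 1) (Fin 1) A := of fun _ _ => a 1
  -- The summand `F` makes `u Z₀ = 1`, so `u` stays invertible nearby and `G` is continuous at the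
  -- base point, with value `Y`.
  let Z₀ : Matrix (Fin L) (Fin L) A := Y * a₁ * X + F
  let T₀ : Matrix (Fin k) (Fin L) A := U * a₂ * X
  let u : Matrix (Fin L) (Fin L) A → Matrix (Fin L) (Fin L) A := fun Z => 1 - F + F * Z * F
  let G : Matrix (Fin L) (Fin L) A → Matrix (Fin L) (Fin 1) A := fun Z =>
    Y - F * Ring.inverse (u Z) * F * Z * Y
  -- A lift of `T` through `U`, by `U * V = q`, normalised to be `a₂ * X` at `T₀`.
  let Z₂ : Matrix (Fin k) (Fin L) A → Matrix (Fin 1) (Fin L) A := fun T =>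
    a₂ * X + V * (T - T₀)
  let val := IsIdempotentElem.Corner.subtype hq
  let C := Matrix (Fin L ⊕ Fin k) (Fin L) hq.Corner
  let P₁ : C → Matrix (Fin L) (Fin L) A := fun M => M.toRows₁.map val
  let P₂ : C → Matrix (Fin k) (Fin L) A := fun M => M.toRows₂.map val
  let φ : C → Fin 2 → A := fun M => ![(X * P₁ M * G (P₁ M)) 0 0, (Z₂ (P₂ M) * G (P₁ M)) 0 0]
  let M₀ : C := (Matrix.fromRows Z₀ T₀).map (IsIdempotentElem.Corner.compress hq)
  have hQF : Q * F = F := by rw [hF, Matrix.mul_sub, hQ, ← Matrix.mul_assoc, hQY]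
  have hFQ : F * Q = F := by rw [hF, Matrix.sub_mul, hQ, Matrix.mul_assoc, hXQ]
  have hP₁ : P₁ M₀ = Z₀ := by
    have h : Q * Z₀ * Q = Z₀ := by
      simp only [Z₀, Matrix.mul_add, Matrix.add_mul, hQF, hFQ]
      rw [Matrix.mul_assoc, Matrix.mul_assoc _ X, hXQ, ← Matrix.mul_assoc, ← Matrix.mul_assoc, hQY]
    ext i j
    have h' := congr_fun₂ h i j
    simp only [hQdef, diagonal_mul, mul_diagonal] at h'
    exact h'
  have hP₂ : P₂ M₀ = T₀ := by
    have h : (diagonal fun _ => q : Matrix (Fin k) (Fin k) A) * T₀ * Q = T₀ := by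
      simp only [T₀]
      rw [Matrix.mul_assoc, Matrix.mul_assoc _ X, hXQ, ← Matrix.mul_assoc, ← Matrix.mul_assoc, hQU]
    ext i j
    have h' := congr_fun₂ h i j
    simp only [hQdef, diagonal_mul, mul_diagonal] at h'
    exact h'
  have hP₁c : Continuous P₁ :=
    (continuous_matrix fun i j => continuous_id.matrix_elem _ _).matrix_map
      (IsIdempotentElem.Corner.continuous_subtype hq)
  have hP₂c : Continuous P₂ :=
    (continuous_matrix fun i j => continuous_id.matrix_elem _ _).matrix_map
      (IsIdempotentElem.Corner.continuous_subtype hq)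
  have hu₀ : u (P₁ M₀) = 1 := by
    simp only [hP₁, u, Z₀]
    rw [Matrix.mul_add, Matrix.add_mul, ← Matrix.mul_assoc, ← Matrix.mul_assoc, hFY, hFF, hFF]
    simp
  have huc : Continuous fun M => u (P₁ M) :=
    continuous_const.add ((continuous_const.matrix_mul hP₁c).matrix_mul continuous_const)
  obtain ⟨hunit, hinv⟩ := Matrix.eventually_isUnit_and_continuousAt_inverse (Fin L) A
  have hunit' : ∀ᶠ M in nhds M₀, IsUnit (u (P₁ M)) :=
    huc.continuousAt.eventually (by simpa only [hu₀] using hunit)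
  have hinv' : ContinuousAt (fun M => Ring.inverse (u (P₁ M))) M₀ :=
    ContinuousAt.comp (f := fun M => u (P₁ M)) (g := Ring.inverse)
      (by simpa only [hu₀] using hinv) huc.continuousAt
  have mulc : ∀ {a b c : ℕ} {f : C → Matrix (Fin a) (Fin b) A} {g : C → Matrix (Fin b) (Fin c) A},
      ContinuousAt f M₀ → ContinuousAt g M₀ → ContinuousAt (fun M => f M * g M) M₀ := by
    intro a b c f g hf hg
    exact ContinuousAt.comp (f := fun M => (f M, g M))
      (g := fun p : Matrix (Fin a) (Fin b) A × Matrix (Fin b) (Fin c) A => p.1 * p.2)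
      (continuous_fst.matrix_mul continuous_snd).continuousAt (hf.prodMk hg)
  have elc : ∀ {f : C → Matrix (Fin 1) (Fin 1) A},
      ContinuousAt f M₀ → ContinuousAt (fun M => f M 0 0) M₀ := by
    intro f hf
    exact ContinuousAt.comp (g := fun p : Matrix (Fin 1) (Fin 1) A => p 0 0)
      (continuous_id.matrix_elem 0 0).continuousAt hf
  have hGc : ContinuousAt (fun M => G (P₁ M)) M₀ :=
    continuousAt_const.sub (mulc (mulc (mulc (mulc continuousAt_const hinv') continuousAt_const)
      hP₁c.continuousAt) continuousAt_const)
  have hφc : ContinuousAt φ M₀ := by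
    refine continuousAt_pi.2 fun i => ?_
    fin_cases i
    · exact elc (mulc (mulc continuousAt_const hP₁c.continuousAt) hGc)
    · exact elc (mulc (continuousAt_const.add
        (mulc continuousAt_const (hP₂c.continuousAt.sub continuousAt_const))) hGc)
  have hG₀ : G (P₁ M₀) = Y := by
    have h : F * Z₀ * Y = 0 := by
      simp only [Z₀, Matrix.mul_add, Matrix.add_mul]
      simp only [← Matrix.mul_assoc, hFY, hFF, Matrix.zero_mul, add_zero]
    simp only [G, hP₁]
    rw [Matrix.mul_assoc _ Z₀, Matrix.mul_assoc _ F, ← Matrix.mul_assoc F, h, Matrix.mul_zero,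
      sub_zero]
  have hφ₀ : φ M₀ = a := by
    funext i
    fin_cases i
    · change (X * P₁ M₀ * G (P₁ M₀)) 0 0 = a 0
      rw [hG₀, hP₁]
      have : X * Z₀ * Y = a₁ := by
        simp only [Z₀, Matrix.mul_add, hXF, add_zero]
        rw [Matrix.mul_assoc, Matrix.mul_assoc _ X, hXY, ← Matrix.mul_assoc, ← Matrix.mul_assoc,
          hXY, Matrix.one_mul, Matrix.mul_one]
      rw [this]; rfl
    · change (Z₂ (P₂ M₀) * G (P₁ M₀)) 0 0 = a 1
      rw [hG₀, hP₂]
      simp only [Z₂, sub_self, Matrix.mul_zero, add_zero]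
      rw [Matrix.mul_assoc, hXY, Matrix.mul_one]; rfl
  have hfreq := mem_closure_iff_frequently.1 (hd M₀)
  have hφt : Filter.Tendsto φ (nhds M₀) (nhds a) := by
    have := hφc.tendsto
    rwa [hφ₀] at this
  refine mem_closure_of_frequently_of_tendsto ((hfreq.and_eventually hunit').mono ?_) hφt
  rintro M ⟨⟨W, hW⟩, hM⟩
  have hWA : W.toCols₁.map val * P₁ M + W.toCols₂.map val * P₂ M = Q := by
    have h1 : W.toCols₁ * M.toRows₁ + W.toCols₂ * M.toRows₂ = 1 := by
      rw [← Matrix.fromCols_mul_fromRows, Matrix.fromCols_toCols, Matrix.fromRows_toRows, hW]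
    have h2 := congr_arg (fun N : Matrix (Fin L) (Fin L) hq.Corner => N.map val) h1
    simp only [Matrix.map_add val (map_add val), Matrix.map_mul] at h2
    refine h2.trans ?_
    rw [hQdef, ← Matrix.diagonal_one, Matrix.diagonal_map (map_zero val)]
    rfl
  have hQZ : Q * P₁ M = P₁ M := by
    ext i j
    rw [hQdef, diagonal_mul]
    exact ((Subsemigroup.mem_corner_iff hq).1 (M.toRows₁ i j).2).1
  have hQP₂ : (diagonal fun _ => q : Matrix (Fin k) (Fin k) A) * P₂ M = P₂ M := by
    ext i j
    rw [diagonal_mul]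
    exact ((Subsemigroup.mem_corner_iff hq).1 (M.toRows₂ i j).2).1
  have hU : U * Z₂ (P₂ M) = P₂ M := by
    simp only [Z₂, T₀]
    rw [Matrix.mul_add, ← Matrix.mul_assoc, ← Matrix.mul_assoc U V, hUV, Matrix.mul_sub, hQP₂,
      ← Matrix.mul_assoc, ← Matrix.mul_assoc, hQU, add_sub_cancel]
  have key := Matrix.mul_schur_compression_eq_one hXY hQ hXQ hQY hQZ hWA hU hF
    (Ring.mul_inverse_cancel _ hM)
  rw [mem_Lg_iff]
  refine ⟨![(X * W.toCols₁.map val * Y) 0 0, (X * W.toCols₂.map val * U) 0 0], ?_⟩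
  have := congr_fun₂ key 0 0
  rw [Matrix.add_apply, Matrix.mul_apply, Matrix.mul_apply (M := X * _ * U)] at this
  simpa [Fin.sum_univ_two, φ, G, u] using this

/-! ### Projections in a simple algebra with (SP) -/

section SimpleSP

variable {D : Type*} [CStarAlgebra D]

theorem star_mul_self_mul_eq_zero {b h : D} (hb : star h * (star b * b) * h = 0) : b * h = 0 := by
  rw [← CStarRing.star_mul_self_eq_zero_iff, star_mul]
  simpa only [mul_assoc] using hb

/-- The annihilator of a self-adjoint element. -/
def selfAdjointAnnihilator (h : D) (hh : IsSelfAdjoint h) : NonUnitalStarSubalgebra ℂ D where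
  carrier := {z | z * h = 0 ∧ h * z = 0}
  add_mem' := fun ⟨h1, h2⟩ ⟨h3, h4⟩ =>
    ⟨by rw [add_mul, h1, h3, add_zero], by rw [mul_add, h2, h4, add_zero]⟩
  zero_mem' := ⟨zero_mul h, mul_zero h⟩
  mul_mem' := fun ⟨_, h2⟩ ⟨h3, _⟩ =>
    ⟨by rw [mul_assoc, h3, mul_zero], by rw [← mul_assoc, h2, zero_mul]⟩
  smul_mem' := fun c z ⟨h1, h2⟩ =>
    ⟨by rw [smul_mul_assoc, h1, smul_zero], by rw [mul_smul_comm, h2, smul_zero]⟩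
  star_mem' := fun {z} ⟨h1, h2⟩ =>
    ⟨by rw [← hh.star_eq, ← star_mul, h2, star_zero],
      by rw [← hh.star_eq, ← star_mul, h1, star_zero]⟩

theorem isHereditary_selfAdjointAnnihilator (h : D) (hh : IsSelfAdjoint h) :
    IsHereditary (selfAdjointAnnihilator h hh) where
  isClosed := (isClosed_eq (continuous_id.mul continuous_const) continuous_const).inter
    (isClosed_eq (continuous_const.mul continuous_id) continuous_const)
  mem_of_le := by
    let _ := CStarAlgebra.spectralOrder D
    have _ := CStarAlgebra.spectralOrderedRing D
    intro a b ha hab hb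
    have hle := star_left_conjugate_le_conjugate hab h
    have h1 : star h * b * h = 0 := by rw [mul_assoc, hb.1, mul_zero]
    have h2 : star h * a * h = 0 := le_antisymm (hle.trans_eq h1) (star_left_conjugate_nonneg ha h)
    obtain ⟨c, rfl⟩ := CStarAlgebra.nonneg_iff_eq_star_mul_self.1 ha
    have h3 : star c * c * h = 0 := by rw [mul_assoc, star_mul_self_mul_eq_zero h2, mul_zero]
    refine ⟨h3, ?_⟩
    have := congr_arg star h3
    simpa [star_mul, hh.star_eq, mul_assoc] using this

/-- Under (SP), a nonzero self-adjoint element annihilating `h` yields a nonzero projection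
annihilating `h`. -/
theorem PropertySP.exists_projection_mul_eq_zero (hSP : PropertySP D) {h z : D}
    (hh : IsSelfAdjoint h) (hz : IsSelfAdjoint z) (hzh : z * h = 0) (hz0 : z ≠ 0) :
    ∃ p : D, IsStarProjection p ∧ p ≠ 0 ∧ p * h = 0 := by
  have hmem : z ∈ selfAdjointAnnihilator h hh := by
    refine ⟨hzh, ?_⟩
    rw [← hh.star_eq, ← hz.star_eq, ← star_mul, hzh, star_zero]
  obtain ⟨p, hp, hp1, hp2⟩ := hSP _ (isHereditary_selfAdjointAnnihilator h hh) (by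
    intro hbot
    rw [hbot, NonUnitalStarAlgebra.mem_bot] at hmem
    exact hz0 hmem)
  exact ⟨p, hp1, hp2, hp.1⟩

/-- In a simple unital C⋆-algebra every nonzero element is full. -/
theorem IsSimpleCStarAlgebra.exists_sum_eq_one (hD : IsSimpleCStarAlgebra D) {q : D} (hq : q ≠ 0) :
    ∃ (n : ℕ) (x y : Fin n → D), ∑ i, x i * q * y i = 1 := by
  let S : Set D := {z | ∃ (n : ℕ) (x y : Fin n → D), ∑ i, x i * q * y i = z}
  have hqS : q ∈ S := ⟨1, 1, 1, by simp⟩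
  let I : TwoSidedIdeal D := TwoSidedIdeal.mk' (closure S)
    (subset_closure ⟨0, 0, 0, by simp⟩)
    (fun {a b} ha hb => map_mem_closure₂ continuous_add ha hb (by
      rintro _ ⟨n, x, y, rfl⟩ _ ⟨m, x', y', rfl⟩
      exact ⟨n + m, Fin.append x x', Fin.append y y', by simp [Fin.sum_univ_add]⟩))
    (fun {a} ha => map_mem_closure (t := S) (f := fun z : D => -z) continuous_neg ha (by
      rintro _ ⟨n, x, y, rfl⟩
      exact ⟨n, -x, y, by simp⟩))
    (fun {a b} hb => map_mem_closure (t := S) (continuous_const_mul a) hb (by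
      rintro _ ⟨n, x, y, rfl⟩
      exact ⟨n, fun i => a * x i, y, by simp [Finset.mul_sum, mul_assoc]⟩))
    (fun {a b} ha => map_mem_closure (t := S) (f := (· * b)) (continuous_mul_const b) ha (by
      rintro _ ⟨n, x, y, rfl⟩
      exact ⟨n, x, fun i => y i * b, by simp [Finset.sum_mul, mul_assoc]⟩))
  have hI : ∀ z, z ∈ I ↔ z ∈ closure S := fun z => TwoSidedIdeal.mem_mk' _ _ _ _ _ _ _
  have hIc : (I : Set D) = closure S := Set.ext hI
  rcases hD.eq_bot_or_eq_top I (hIc ▸ isClosed_closure) with h | h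
  · have : q ∈ I := (hI q).2 (subset_closure hqS)
    rw [h, TwoSidedIdeal.mem_bot] at this
    exact absurd this hq
  · have h1 : (1 : D) ∈ closure S := (hI 1).1 (h ▸ TwoSidedIdeal.mem_top _)
    -- Units are open, so some finite sum is already invertible; its inverse is absorbed into `x`.
    obtain ⟨_, hu, n, x, y, rfl⟩ := mem_closure_iff.1 h1 _ Units.isOpen isUnit_one
    refine ⟨n, fun i => Ring.inverse (∑ i, x i * q * y i) * x i, y, ?_⟩
    refine Eq.trans ?_ (Ring.inverse_mul_cancel _ hu)
    rw [Finset.mul_sum]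
    simp only [mul_assoc]

/-- Otherwise `pDp` is `ℂp`; writing `d = 1 * d * 1` with `1 = ∑ x i * p * y i` puts every `d` in
the span of the finitely many `x i * p * y j`. -/
theorem IsSimpleCStarAlgebra.exists_ne_smul (hD : IsSimpleCStarAlgebra D)
    (hinf : ¬ FiniteDimensional ℂ D) {p : D} (hp : IsStarProjection p) (hp0 : p ≠ 0) :
    ∃ a : D, IsSelfAdjoint a ∧ p * a = a ∧ a * p = a ∧ ∀ t : ℝ, a ≠ t • p := by
  by_contra! hcon
  have hpp := hp.isIdempotentElem.eq
  have hps := hp.isSelfAdjoint.star_eq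
  have hscalar : ∀ d : D, ∃ c : ℂ, p * d * p = c • p := by
    intro d
    have key : ∀ s : D, IsSelfAdjoint s → ∃ t : ℝ, p * s * p = t • p := by
      intro s hs
      refine hcon (p * s * p) ?_ ?_ ?_
      · rw [IsSelfAdjoint, star_mul, star_mul, hs.star_eq, hps, mul_assoc]
      · rw [← mul_assoc, ← mul_assoc, hpp]
      · rw [mul_assoc, hpp]
    obtain ⟨t, ht⟩ := key (realPart d) (realPart d).2
    obtain ⟨s, hs⟩ := key (imaginaryPart d) (imaginaryPart d).2
    refine ⟨t + Complex.I * s, ?_⟩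
    conv_lhs => rw [← realPart_add_I_smul_imaginaryPart d]
    rw [mul_add, add_mul, ht, mul_smul_comm, smul_mul_assoc, hs, add_smul, mul_smul]
    simp
  choose c hc using hscalar
  obtain ⟨n, x, y, hxy⟩ := hD.exists_sum_eq_one hp0
  classical
  refine hinf ⟨⟨Finset.univ.image fun ij : Fin n × Fin n => x ij.1 * p * y ij.2, ?_⟩⟩
  rw [eq_top_iff]
  intro d _
  have : d = ∑ i, ∑ j, c (y i * d * x j) • (x i * p * y j) := by
    calc d = (∑ i, x i * p * y i) * d * (∑ j, x j * p * y j) := by rw [hxy, one_mul, mul_one]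
      _ = ∑ i, ∑ j, x i * (p * (y i * d * x j) * p) * y j := by
        simp only [Finset.sum_mul, Finset.mul_sum, mul_assoc]
        exact Finset.sum_comm
      _ = _ := by simp only [hc, mul_smul_comm, smul_mul_assoc]
  rw [this]
  refine Submodule.sum_mem _ fun i _ => Submodule.sum_mem _ fun j _ => Submodule.smul_mem _ _ ?_
  exact Submodule.subset_span (by simp)

theorem PropertySP.exists_orthogonal_of_ne_smul (hSP : PropertySP D) {p a : D}
    (hp : IsStarProjection p) (ha : IsSelfAdjoint a) (hpa : p * a = a) (hap : a * p = a)
    (hne : ∀ t : ℝ, a ≠ t • p) :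
    ∃ e f : D, IsStarProjection e ∧ IsStarProjection f ∧ e ≠ 0 ∧ f ≠ 0 ∧ f * e = 0 ∧
      e * p = e ∧ f * p = f := by
  let _ := CStarAlgebra.spectralOrder D
  have _ := CStarAlgebra.spectralOrderedRing D
  have hpp := hp.isIdempotentElem.eq
  have hps := hp.isSelfAdjoint
  -- If no `t` worked, two nonempty closed sets would cover `ℝ`; by connectedness they meet, and
  -- there `a = t • p`. So `a - t • p` has nonzero positive and negative parts.
  obtain ⟨t, ht1, ht2⟩ : ∃ t : ℝ, ¬ t • p ≤ a ∧ ¬ a ≤ t • p := by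
    by_contra! hcon
    have hc : Continuous fun t : ℝ => t • p := continuous_id.smul continuous_const
    have hconj : ∀ s : ℝ, star p * algebraMap ℝ D s * p = s • p := by
      intro s
      rw [hps.star_eq, Algebra.algebraMap_eq_smul_one, mul_smul_comm, mul_one, smul_mul_assoc, hpp]
    have hconja : star p * a * p = a := by rw [hps.star_eq, hpa, hap]
    have h1 : ((-‖a‖ : ℝ)) • p ≤ a := by
      have := star_left_conjugate_le_conjugate ha.neg_algebraMap_norm_le_self p
      rwa [← map_neg, hconj, hconja] at this
    have h2 : a ≤ ‖a‖ • p := by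
      have := star_left_conjugate_le_conjugate ha.le_algebraMap_norm_self p
      rwa [hconj, hconja] at this
    obtain ⟨t, -, ht1, ht2⟩ := isPreconnected_closed_iff.1 isPreconnected_univ
      {t : ℝ | t • p ≤ a} {t : ℝ | a ≤ t • p} (isClosed_le hc continuous_const)
      (isClosed_le continuous_const hc)
      (fun t _ => (em (t • p ≤ a)).imp id (hcon t)) ⟨_, trivial, h1⟩ ⟨_, trivial, h2⟩
    exact hne t (le_antisymm ht2 ht1)
  set b := a - t • p with hb
  have hbs : IsSelfAdjoint b := ha.sub ((IsSelfAdjoint.all t).smul hps)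
  have hbp : b * (1 - p) = 0 := by
    rw [hb, mul_sub, mul_one, sub_mul, hap, smul_mul_assoc, hpp, sub_self]
  have hb12 : b⁺ * b⁻ = 0 := CFC.posPart_mul_negPart b
  have hbd : b⁺ - b⁻ = b := CFC.posPart_sub_negPart b
  have hs1 : IsSelfAdjoint b⁺ := (CFC.posPart_nonneg b).isSelfAdjoint
  have hs2 : IsSelfAdjoint b⁻ := (CFC.negPart_nonneg b).isSelfAdjoint
  have hn1 : b⁺ ≠ 0 := by
    intro h
    rw [h, zero_sub] at hbd
    refine ht2 (sub_nonpos.1 ?_)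
    rw [← hb, ← hbd]
    exact neg_nonpos.2 (CFC.negPart_nonneg b)
  have hn2 : b⁻ ≠ 0 := by
    intro h
    rw [h, sub_zero] at hbd
    refine ht1 (sub_nonneg.1 ?_)
    rw [← hb, ← hbd]
    exact CFC.posPart_nonneg b
  have hp1 : b⁺ * (1 - p) = 0 := by
    apply star_mul_self_mul_eq_zero
    have : b⁺ * b⁺ = b⁺ * b := by
      have h := mul_sub b⁺ b⁺ b⁻
      rw [hbd, hb12, sub_zero] at h
      exact h.symm
    rw [hs1.star_eq, this, mul_assoc, mul_assoc, hbp, mul_zero, mul_zero]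
  have hp2 : b⁻ * (1 - p) = 0 := by
    have h := hbp
    rw [← hbd, sub_mul, hp1, zero_sub, neg_eq_zero] at h
    exact h
  have h1p : IsSelfAdjoint (1 - p) := (IsSelfAdjoint.one D).sub hps
  have h1pp : (1 - p) * (1 - p) = 1 - p := hp.isIdempotentElem.one_sub.eq
  -- Including `1 - p` in the annihilated element forces the projection below `p`.
  obtain ⟨e, he, he0, heh⟩ := hSP.exists_projection_mul_eq_zero (h := b⁻ + (1 - p)) (z := b⁺)
    (hs2.add h1p) hs1 (by rw [mul_add, hb12, hp1, add_zero]) hn1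
  have he1 : e * (1 - p) = 0 := by
    have := congr_arg (· * (1 - p)) heh
    simpa only [mul_assoc, add_mul, hp2, h1pp, zero_add, zero_mul] using this
  have heb : e * b⁻ = 0 := by rwa [mul_add, he1, add_zero] at heh
  have hbe : b⁻ * e = 0 := by
    rw [← hs2.star_eq, ← he.isSelfAdjoint.star_eq, ← star_mul, heb, star_zero]
  have hpe : (1 - p) * e = 0 := by
    rw [← h1p.star_eq, ← he.isSelfAdjoint.star_eq, ← star_mul, he1, star_zero]
  obtain ⟨f, hf, hf0, hfh⟩ := hSP.exists_projection_mul_eq_zero (h := e + (1 - p)) (z := b⁻)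
    (he.isSelfAdjoint.add h1p) hs2 (by rw [mul_add, hbe, hp2, add_zero]) hn2
  have hfe : f * e = 0 := by
    have := congr_arg (· * e) hfh
    simpa only [mul_assoc, add_mul, hpe, he.isIdempotentElem.eq, add_zero, zero_mul] using this
  have hf1 : f * (1 - p) = 0 := by rwa [mul_add, hfe, zero_add] at hfh
  refine ⟨e, f, he, hf, he0, hf0, hfe, ?_, ?_⟩
  · rw [mul_sub, mul_one, sub_eq_zero] at he1; exact he1.symm
  · rw [mul_sub, mul_one, sub_eq_zero] at hf1; exact hf1.symm

/-- Functional calculus: a nonzero positive `y` is bounded below on some nonzero spectral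
subspace. -/
theorem exists_cutoff_of_star_mul_self {x : D} (hx : x ≠ 0) :
    ∃ z H : D, IsSelfAdjoint z ∧ z ≠ 0 ∧ IsSelfAdjoint (star x * x * H) ∧
      z * (1 - star x * x * H) = 0 ∧ Commute (star x * x) H := by
  let _ := CStarAlgebra.spectralOrder D
  have _ := CStarAlgebra.spectralOrderedRing D
  set y := star x * x with hy
  have hy0 : 0 ≤ y := star_mul_self_nonneg x
  have hys : IsSelfAdjoint y := hy0.isSelfAdjoint
  have hyn : y ≠ 0 := by rwa [hy, Ne, CStarRing.star_mul_self_eq_zero_iff]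
  -- Since `c < ‖y‖`, the cutoff `z = (y - c)⁺` is nonzero. With `H = max(y, c)⁻¹`, the function `t
  -- * (max t c)⁻¹` is 1 wherever `z` lives.
  set c := ‖y‖ / 2 with hc
  have hc0 : 0 < c := half_pos (norm_pos_iff.2 hyn)
  have hcont : Continuous fun t : ℝ => (max t c)⁻¹ :=
    (continuous_id.max continuous_const).inv₀ fun t => (lt_max_of_lt_right hc0).ne'
  have hcz : Continuous fun t : ℝ => max (t - c) 0 := by fun_prop
  refine ⟨cfc (fun t : ℝ => max (t - c) 0) y, cfc (fun t : ℝ => (max t c)⁻¹) y,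
    cfc_predicate _ _, ?_, ?_, ?_, ?_⟩
  · intro h
    have hle : y ≤ algebraMap ℝ D c := by
      rw [← sub_nonpos]
      have h1 : y - algebraMap ℝ D c = cfc (fun t : ℝ => t - c) y := by
        rw [cfc_sub _ _ y, cfc_id' ℝ y, cfc_const c y]
      rw [h1, ← h]
      exact cfc_mono (fun t _ => le_max_left _ _)
    rw [← CStarAlgebra.norm_le_iff_le_algebraMap y hc0.le] at hle
    have : 0 < ‖y‖ := norm_pos_iff.2 hyn
    linarith
  · have : y * cfc (fun t : ℝ => (max t c)⁻¹) y = cfc (fun t : ℝ => t * (max t c)⁻¹) y := by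
      rw [cfc_mul _ _ y (by fun_prop) hcont.continuousOn, cfc_id' ℝ y]
    rw [this]
    exact cfc_predicate _ _
  · have : y * cfc (fun t : ℝ => (max t c)⁻¹) y = cfc (fun t : ℝ => t * (max t c)⁻¹) y := by
      rw [cfc_mul _ _ y (by fun_prop) hcont.continuousOn, cfc_id' ℝ y]
    have hcm : Continuous fun t : ℝ => t * (max t c)⁻¹ := continuous_id.mul hcont
    rw [this, mul_sub, mul_one, ← cfc_mul _ _ y hcz.continuousOn hcm.continuousOn, sub_eq_zero]
    refine cfc_congr fun t _ => ?_
    rcases le_total t c with h | h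
    · simp [h]
    · have : t ≠ 0 := (hc0.trans_le h).ne'
      simp [h, this]
  · have := cfc_commute_cfc (fun t : ℝ => t) (fun t : ℝ => (max t c)⁻¹) y
    rwa [cfc_id' ℝ y] at this

/-- Below a nonzero projection there are two orthogonal copies of a nonzero projection. -/
theorem PropertySP.exists_two_copies (hSP : PropertySP D) (hD : IsSimpleCStarAlgebra D)
    (hinf : ¬ FiniteDimensional ℂ D) {p : D} (hp : IsStarProjection p) (hp0 : p ≠ 0) :
    ∃ q : D, IsStarProjection q ∧ q ≠ 0 ∧ ∃ u v : Fin 2 → D,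
      (∀ i, q * u i = u i) ∧ (∀ i, p * v i = v i) ∧
      ∀ i j, u i * v j = if i = j then q else 0 := by
  obtain ⟨a, ha, hpa, hap, hne⟩ := hD.exists_ne_smul hinf hp hp0
  obtain ⟨e, f, he, hf, he0, hf0, hfe, hep, hfp⟩ :=
    hSP.exists_orthogonal_of_ne_smul hp ha hpa hap hne
  have hes := he.isSelfAdjoint.star_eq
  have hfs := hf.isSelfAdjoint.star_eq
  have hps := hp.isSelfAdjoint.star_eq
  have hee := he.isIdempotentElem.eq
  have hff := hf.isIdempotentElem.eq
  have hpe : p * e = e := by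
    have := congr_arg star hep
    rwa [star_mul, hes, hps] at this
  have hpf : p * f = f := by
    have := congr_arg star hfp
    rwa [star_mul, hfs, hps] at this
  have hef : e * f = 0 := by rw [← hes, ← hfs, ← star_mul, hfe, star_zero]
  -- If `e * D * f = 0`, fullness of `e` would give `f = 0`.
  obtain ⟨d, hd⟩ : ∃ d, e * d * f ≠ 0 := by
    by_contra! hcon
    obtain ⟨n, x, y, hxy⟩ := hD.exists_sum_eq_one he0
    refine hf0 ?_
    calc f = (∑ i, x i * e * y i) * f := by rw [hxy, one_mul]
      _ = ∑ i, x i * (e * y i * f) := by simp only [Finset.sum_mul, mul_assoc]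
      _ = 0 := by simp [hcon]
  set x := e * d * f with hx
  have hex : e * x = x := by rw [hx, ← mul_assoc, ← mul_assoc, hee]
  have hxf : x * f = x := by rw [hx, mul_assoc, hff]
  obtain ⟨z, H, hzs, hz0, hgs, hzg, hcomm⟩ := exists_cutoff_of_star_mul_self hd
  obtain ⟨q, hq, hq0, hqg⟩ :=
    hSP.exists_projection_mul_eq_zero ((IsSelfAdjoint.one D).sub hgs) hzs hzg hz0
  have hqs := hq.isSelfAdjoint.star_eq
  have hqq := hq.isIdempotentElem.eq
  have hqg' : q * (star x * x * H) = q := by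
    rw [mul_sub, mul_one, sub_eq_zero] at hqg
    exact hqg.symm
  have hqf : q * f = q := by
    rw [← hqg', hcomm.eq, mul_assoc q, mul_assoc H, mul_assoc (star x), hxf]
  have hfq : f * q = q := by
    have := congr_arg star hqf
    rwa [star_mul, hfs, hqs] at this
  have hxq : star x * q = 0 := by
    rw [← hex, ← hfq, star_mul, hes, mul_assoc, ← mul_assoc e, hef, zero_mul, mul_zero]
  have hqx : q * x = 0 := by
    rw [← hex, ← hqf, mul_assoc, ← mul_assoc f, hfe, zero_mul, mul_zero]
  -- One copy of `q` is transported by `x` under `e`, with `H` undoing `star x * x` on `q`; the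
  -- other is `q` itself, under `f`.
  refine ⟨q, hq, hq0, ![q * star x, q], ![x * H * q, q], ?_, ?_, ?_⟩
  · intro i
    fin_cases i <;> simp [← mul_assoc, hqq]
  · intro i
    fin_cases i
    · change p * (x * H * q) = x * H * q
      rw [← hex]
      simp only [← mul_assoc, hpe]
    · change p * q = q
      rw [← hfq, ← mul_assoc, hpf]
  · intro i j
    fin_cases i <;> fin_cases j
    · change q * star x * (x * H * q) = q
      calc _ = q * (star x * x * H) * q := by simp only [mul_assoc]
        _ = q := by rw [hqg', hqq]
    · change q * star x * q = 0
      rw [mul_assoc, hxq, mul_zero]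
    · change q * (x * H * q) = 0
      simp only [← mul_assoc, hqx, zero_mul]
    · exact hqq

/-- Each copy of `p` receives two copies of a smaller `q`, so the number doubles. -/
theorem PropertySP.exists_copies_two_pow (hSP : PropertySP D) (hD : IsSimpleCStarAlgebra D)
    (hinf : ¬ FiniteDimensional ℂ D) (n : ℕ) :
    ∃ q : D, IsStarProjection q ∧ q ≠ 0 ∧ ∃ u v : Fin (2 ^ n) → D,
      (∀ i, q * u i = u i) ∧ ∀ i j, u i * v j = if i = j then q else 0 := by
  induction n with
  | zero =>
    have := hD.nontrivial
    exact ⟨1, .one D, one_ne_zero, 1, 1, by simp,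
      fun i j => by simp [show i = j from Fin.ext (by lia)]⟩
  | succ n ih =>
    obtain ⟨p, hp, hp0, u, v, hu, huv⟩ := ih
    obtain ⟨q, hq, hq0, u', v', hu', hv', huv'⟩ := hSP.exists_two_copies hD hinf hp hp0
    let E : Fin (2 ^ (n + 1)) ≃ Fin (2 ^ n) × Fin 2 :=
      (finCongr (pow_succ 2 n)).trans finProdFinEquiv.symm
    refine ⟨q, hq, hq0, fun i => u' (E i).2 * u (E i).1, fun i => v (E i).1 * v' (E i).2, ?_, ?_⟩
    · intro i
      rw [← mul_assoc, hu']
    · intro i j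
      have hE : i = j ↔ (E i).1 = (E j).1 ∧ (E i).2 = (E j).2 := by
        rw [← Prod.ext_iff, E.apply_eq_iff_eq]
      rw [mul_assoc, ← mul_assoc (u _), huv]
      split_ifs with h1 h2 h2
      · rw [hv', huv', if_pos (hE.1 h2).2]
      · rw [hv', huv', if_neg fun h => h2 (hE.2 ⟨h1, h⟩)]
      · exact absurd (hE.1 h2).1 h1
      · rw [zero_mul, mul_zero]

end SimpleSP

/-! ### Conclusion -/

theorem exists_dense_Lg_of_tsr_lt_top {R : Type*} [Ring R] [TopologicalSpace R]
    (h : tsr R < ⊤) : ∃ k : ℕ, Dense (Lg R (k + 1)) ∧ (k : ℕ∞) ≤ tsr R := by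
  have hne : {m : ℕ∞ | ∃ n : ℕ, 1 ≤ n ∧ Dense (Lg R n) ∧ m = n}.Nonempty := by
    by_contra hcon
    rw [Set.not_nonempty_iff_eq_empty] at hcon
    rw [tsr, hcon, sInf_empty] at h
    exact lt_irrefl _ h
  obtain ⟨n, hn, hd, he⟩ := csInf_mem hne
  obtain ⟨k, rfl⟩ := Nat.exists_eq_add_of_le' hn
  refine ⟨k, hd, ?_⟩
  rw [tsr, he]
  exact_mod_cast Nat.le_succ k

theorem mainTheorem1 {A : Type*} [CStarAlgebra A] (D : StarSubalgebra ℂ A)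
    [IsClosed (D : Set A)] (hD : ¬ FiniteDimensional ℂ D)
    (hsimple : IsSimpleCStarAlgebra D) (hSP : PropertySP D)
    (hsup : (⨆ p : {p : A // p ∈ D ∧ IsStarProjection p},
      tsr p.2.2.isIdempotentElem.Corner) < ⊤) :
    tsr A ≤ 2 := by
  obtain ⟨N, hN⟩ := ENat.ne_top_iff_exists.1 hsup.ne
  -- `N` is uniform over all corners, so the number of copies can be fixed before the rank of the
  -- corner at `q` is known.
  obtain ⟨q, hq, hq0, u, v, hu, huv⟩ := hSP.exists_copies_two_pow hsimple hD N
  obtain ⟨L, x, y, hxy⟩ := hsimple.exists_sum_eq_one hq0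
  have hqA : IsStarProjection (q : A) :=
    ⟨congr_arg Subtype.val hq.isIdempotentElem.eq, congr_arg Subtype.val hq.isSelfAdjoint.star_eq⟩
  have hqq := hqA.isIdempotentElem.eq
  have hle := le_iSup (fun p : {p : A // p ∈ D ∧ IsStarProjection p} =>
    tsr p.2.2.isIdempotentElem.Corner) ⟨q, q.2, hqA⟩
  obtain ⟨k, hk, hkle⟩ := exists_dense_Lg_of_tsr_lt_top (hle.trans_lt hsup)
  have hkN : k ≤ N := by exact_mod_cast (hkle.trans hle).trans_eq hN.symm
  have hk2 : k ≤ 2 ^ N := hkN.trans Nat.lt_two_pow_self.le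
  refine sInf_le ⟨2, one_le_two, ?_, rfl⟩
  refine dense_Lg_two_of_corner hqA.isIdempotentElem (L := L)
    (X := Matrix.of fun _ i => (x i : A) * q) (Y := Matrix.of fun i _ => (q : A) * y i)
    (U := Matrix.of fun i _ => (u (Fin.castLE hk2 i) : A))
    (V := Matrix.of fun _ i => (v (Fin.castLE hk2 i) : A)) ?_ ?_ ?_ ?_ ?_ (.of_dense_Lg hk L)
  · ext i j
    obtain rfl := Subsingleton.elim i j
    have := congr_arg (Subtype.val : D → A) hxy
    simp only [AddSubmonoidClass.coe_finsetSum, MulMemClass.coe_mul, OneMemClass.coe_one] at this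
    rw [Matrix.mul_apply, Matrix.one_apply_eq, ← this]
    refine Finset.sum_congr rfl fun i _ => ?_
    simp only [Matrix.of_apply]
    rw [mul_assoc, ← mul_assoc (q : A), hqq, mul_assoc]
  · ext i j
    simp only [Matrix.mul_diagonal, Matrix.of_apply]
    rw [mul_assoc, hqq]
  · ext i j
    simp only [Matrix.diagonal_mul, Matrix.of_apply]
    rw [← mul_assoc, hqq]
  · ext i j
    have := congr_arg (Subtype.val : D → A) (huv (Fin.castLE hk2 i) (Fin.castLE hk2 j))
    rw [Matrix.mul_apply, Fintype.sum_unique, Matrix.diagonal_apply]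
    refine this.trans ?_
    simp only [Fin.castLE_inj]
    split_ifs <;> rfl
  · ext i j
    simp only [Matrix.diagonal_mul, Matrix.of_apply]
    exact congr_arg Subtype.val (hu _)
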